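/- Let $h\in(0,1)$. The state $\omega$ has the normal prior density $\mu_0$ with mean $\omega_0\in\mathbb R$ and variance $\sigma_0^2>0$. Given $\omega$, a signal has density $f(s|\omega)=h f_H(s|\omega)+(1-h)f_L(s|\omega)$, where $f_q(\cdot|\omega)$ is the normal density with mean $\omega$ and variance $\sigma_q^2>0$, $q\in\{H,L\}$. The agent chooses a sampling variance $\sigma_\gamma^2\in(0,\infty]$; with $\gamma$ the normal density with mean $\omega_0$ and variance $\sigma_\gamma^2$ (and $\gamma\equiv 1$, i.e. uniform sampling, if $\sigma_\gamma^2=\infty$), she observes a signal $s$ with density $$g(s|\omega,\sigma_\gamma^2)=\frac{\gamma(s)f(s|\omega)}{\int\gamma(s')f(s'|\omega)\,ds'},$$ then plays an action $a(s,\sigma_\gamma^2)$, and has expected utility $$U_a(\sigma_\gamma^2)=-\int\Big[\int\big(\omega-a(s,\sigma_\gamma^2)\big)^2 g(s|\omega,\sigma_\gamma^2)\,ds\Big]\mu_0(\omega)\,d\omega .$$ Consider the following two action rules $a$: (a) the optimal action, i.e. the posterior expectation $$a^\star(s,\sigma_\gamma^2)=\frac{\int\omega\, g(s|\omega,\sigma_\gamma^2)\mu_0(\omega)\,d\omega}{\int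 g(s|\omega,\sigma_\gamma^2)\mu_0(\omega)\,d\omega};$$ (b) the weighted action $\bar\alpha_\gamma(s)\,\omega_0+(1-\bar\alpha_\gamma(s))\,s$, where $\bar\alpha_\gamma(s)=P(H|s)\alpha_{\gamma H}+(1-P(H|s))\alpha_{\gamma L}$, $\alpha_{\gamma q}=\sigma_0^{-2}/(\sigma_0^{-2}+\sigma_\gamma^{-2}+\sigma_q^{-2})$ (with $\sigma_\gamma^{-2}=0$ if $\sigma_\gamma^2=\infty$) and $P(H|s)=h\int f_H(s|\omega)\mu_0(\omega)\,d\omega\big/\int f(s|\omega)\mu_0(\omega)\,d\omega$. Then for any $h\in(0,1)$, $\sigma_0^2>0$ and $\sigma_H^2>0$ there is a threshold $\kappa^*\in(\sigma_H^2,\infty)$ such that for all $\omega_0\in\mathbb R$ and all $\sigma_L^2>\kappa^*$ the optimal sampling variance is finite: under each of the action rules (a) and (b), $U_a$ attains its maximum over $(0,\infty]$, and every maximizer is finite. -/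

import Mathlib

open MeasureTheory ProbabilityTheory
open scoped NNReal ENNReal

noncomputable section

/-- Parameters of the normal-sampling model: the fraction `h` of high-quality sources, the prior
mean `ω₀`, the prior variance `v₀`, and the variances `vH`, `vL` of the signals of high- and
low-quality sources. -/
structure NormalSampling where
  h : ℝ
  ω₀ : ℝ
  v₀ : ℝ≥0
  vH : ℝ≥0
  vL : ℝ≥0

namespace NormalSampling

variable (M : NormalSampling)

/-- The prior density `μ₀` of the state. -/
def prior (ω : ℝ) : ℝ := gaussianPDFReal M.ω₀ M.v₀ ω

/-- The density `f_H(s|ω)` of a high-quality signal. -/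
def fH (ω s : ℝ) : ℝ := gaussianPDFReal ω M.vH s

/-- The density `f_L(s|ω)` of a low-quality signal. -/
def fL (ω s : ℝ) : ℝ := gaussianPDFReal ω M.vL s

/-- The total signal density `f(s|ω)`. -/
def f (ω s : ℝ) : ℝ := M.h * M.fH ω s + (1 - M.h) * M.fL ω s

/-- The sampling function `γ` with variance `v ∈ (0, ∞]`: the normal density centred at the prior
mean if `v` is finite, and the constant weight `1` (uniform sampling) if `v = ∞`. -/
def γ (v : ℝ≥0∞) (s : ℝ) : ℝ :=
  if v = ∞ then 1 else gaussianPDFReal M.ω₀ v.toNNReal s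

/-- The density `g(s|ω, v)` of the sampled signal, given the state and the sampling variance. -/
def g (v : ℝ≥0∞) (ω s : ℝ) : ℝ :=
  M.γ v s * M.f ω s / ∫ s', M.γ v s' * M.f ω s'

/-- The optimal action after the signal `s`, that is, the posterior expectation of the state. -/
def bayesAction (v : ℝ≥0∞) (s : ℝ) : ℝ :=
  (∫ ω, ω * (M.g v ω s * M.prior ω)) / ∫ ω, M.g v ω s * M.prior ω

/-- The probability `P(H|s)` that a signal `s` comes from a high-quality source. -/
def probH (s : ℝ) : ℝ :=
  (∫ ω, M.h * M.fH ω s * M.prior ω) / ∫ ω, M.f ω s * M.prior ω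

/-- The weight on the prior mean for a source of variance `vq`, where `1 / ∞ = 0`. -/
def α (v : ℝ≥0∞) (vq : ℝ≥0) : ℝ :=
  (M.v₀ : ℝ)⁻¹ / ((M.v₀ : ℝ)⁻¹ + (v⁻¹).toReal + (vq : ℝ)⁻¹)

/-- The averaged weight on the prior mean after the signal `s`. -/
def αbar (v : ℝ≥0∞) (s : ℝ) : ℝ :=
  M.probH s * M.α v M.vH + (1 - M.probH s) * M.α v M.vL

/-- The closed-form action: the average of the prior mean and the signal with weights `αbar` and
`1 - αbar`. -/
def weightedAction (v : ℝ≥0∞) (s : ℝ) : ℝ :=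
  M.αbar v s * M.ω₀ + (1 - M.αbar v s) * s

/-- Expected quadratic loss of the action rule `a` under the sampling variance `v`; an integral of
a nonnegative function, with values in `[0, ∞]`. -/
def expectedLoss (v : ℝ≥0∞) (a : ℝ → ℝ) : ℝ≥0∞ :=
  ∫⁻ ω, (∫⁻ s, ENNReal.ofReal ((ω - a s) ^ 2 * M.g v ω s)) * ENNReal.ofReal (M.prior ω)

/-- Expected utility, for the utility function `-(a - ω)²`. -/
def expectedUtility (v : ℝ≥0∞) (a : ℝ → ℝ) : EReal := -(M.expectedLoss v a : EReal)

/-- `v` is an optimal sampling variance, among all variances in `(0, ∞]`, for an agent who plays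
the action rule `a w` when the sampling variance is `w`. -/
def IsOptimalVariance (a : ℝ≥0∞ → ℝ → ℝ) (v : ℝ≥0∞) : Prop :=
  0 < v ∧ ∀ w : ℝ≥0∞, 0 < w → M.expectedUtility w (a w) ≤ M.expectedUtility v (a v)

end NormalSampling

end

/-!
Encode a sampling variance `v ∈ (0, ∞]` by `x = v / (1 + v) ∈ (0, 1]`, centre the state as
`δ = ω - ω₀` and rescale the signal as `s = ω₀ + √x * r`. The joint density of `(δ, r)` and both
action rules then extend continuously to `x = 0`, so that by Fatou's lemma the expected loss is
lower semicontinuous on `[0, 1]` and attains its minimum there. It remains to find an interior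
point that beats both endpoints.

At both endpoints the loss of every action rule is at least `h * τ_H + (1 - h) * τ_L`, where `τ_q`
is the posterior variance after a signal of variance `v_q`: at `x = 0` the signal carries no
information, and at `x = 1` (uniform sampling) this is the loss of an agent who also learns the
quality of the source. As `v_L → ∞` this bound tends to `h * τ_H + (1 - h) * v₀`. For fixed
`x < 1`, however, the sampling function makes the total mass of the low-quality signals vanish, so
in the limit only high-quality signals are observed; by dominated convergence the loss of the
weighted action tends to an explicit expression, which is continuous in `x` and equal to `τ_H` at
`x = 1`. As `τ_H < v₀`, some `x < 1` does better than the bound once `v_L` is large, and the Bayes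
action does at least as well as the weighted action.
-/

noncomputable section

open Filter Topology Set

/-! ### Gaussian densities -/

section Gaussian

theorem gaussianPDFReal_le_inv_sqrt (m : ℝ) (v : ℝ≥0) (x : ℝ) :
    gaussianPDFReal m v x ≤ (√(2 * Real.pi * v))⁻¹ := by
  rw [gaussianPDFReal]
  refine mul_le_of_le_one_right (by positivity) (Real.exp_le_one_iff.2 ?_)
  exact div_nonpos_of_nonpos_of_nonneg (neg_nonpos.2 (sq_nonneg _)) (by positivity)

theorem gaussianPDFReal_add_add (c m x : ℝ) (v : ℝ≥0) :
    gaussianPDFReal (c + m) v (c + x) = gaussianPDFReal m v x := by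
  simp [gaussianPDFReal]

theorem continuous_gaussianPDFReal (m : ℝ) (v : ℝ≥0) : Continuous (gaussianPDFReal m v) := by
  unfold gaussianPDFReal
  fun_prop

theorem tendsto_gaussianPDFReal_add_atTop (m x : ℝ) (p : ℝ≥0) :
    Tendsto (fun q : ℝ≥0 => gaussianPDFReal m (p + q) x) atTop (𝓝 0) := by
  have hvar : Tendsto (fun q : ℝ≥0 => 2 * Real.pi * ((p + q : ℝ≥0) : ℝ)) atTop atTop :=
    (NNReal.tendsto_coe_atTop.2 (tendsto_atTop_mono (fun q => le_add_self)
      tendsto_id)).const_mul_atTop Real.two_pi_pos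
  exact squeeze_zero (fun q => gaussianPDFReal_nonneg _ _ _)
    (fun q => gaussianPDFReal_le_inv_sqrt _ _ _)
    (Real.tendsto_sqrt_atTop.comp hvar).inv_tendsto_atTop

variable {v : ℝ≥0}

theorem integrable_mul_gaussianPDFReal_iff (m : ℝ) (hv : v ≠ 0) (u : ℝ → ℝ) :
    Integrable (fun x => u x * gaussianPDFReal m v x) ↔ Integrable u (gaussianReal m v) := by
  rw [gaussianReal_of_var_ne_zero m hv, integrable_withDensity_iff (measurable_gaussianPDF m v)
    (ae_of_all _ fun x => gaussianPDF_lt_top)]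
  simp only [toReal_gaussianPDF]

theorem integrable_pow_mul_gaussianPDFReal (m : ℝ) (hv : v ≠ 0) (n : ℕ) :
    Integrable fun x => x ^ n * gaussianPDFReal m v x :=
  (integrable_mul_gaussianPDFReal_iff m hv _).2 <| (integrable_norm_iff (by fun_prop)).1 <| by
    simpa only [norm_pow, id] using
      (memLp_id_gaussianReal (μ := m) (v := v) n).integrable_norm_pow'

theorem lintegral_mul_gaussianPDFReal (m : ℝ) (hv : v ≠ 0) (u : ℝ → ℝ) :
    ∫⁻ x, ENNReal.ofReal (u x * gaussianPDFReal m v x) =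
      ∫⁻ x, ENNReal.ofReal (u x) ∂gaussianReal m v := by
  rw [gaussianReal_of_var_ne_zero m hv, lintegral_withDensity_eq_lintegral_mul_non_measurable _
    (measurable_gaussianPDF m v) (ae_of_all _ fun x => gaussianPDF_lt_top)]
  simp only [Pi.mul_apply, gaussianPDF, ENNReal.ofReal_mul' (gaussianPDFReal_nonneg m v _),
    mul_comm]

theorem integral_sq_gaussianReal (m : ℝ) (v : ℝ≥0) :
    ∫ x, x ^ 2 ∂gaussianReal m v = m ^ 2 + v := by
  have h := variance_eq_sub (memLp_id_gaussianReal (μ := m) (v := v) 2)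
  simp only [variance_id_gaussianReal, Pi.pow_apply, id, integral_id_gaussianReal] at h
  linarith

theorem lintegral_sub_mul_sq_gaussianReal (a b m : ℝ) (v : ℝ≥0) :
    ∫⁻ x, ENNReal.ofReal ((a - b * x) ^ 2) ∂gaussianReal m v =
      ENNReal.ofReal ((a - b * m) ^ 2 + b ^ 2 * v) := by
  have hmap : (gaussianReal m v).map (fun x => a - b * x) =
      gaussianReal (a - b * m) (NNReal.mk (b ^ 2) (sq_nonneg b) * v) := by
    rw [← gaussianReal_map_const_sub, ← gaussianReal_map_const_mul,
      Measure.map_map (by fun_prop) (by fun_prop)]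
    rfl
  calc ∫⁻ x, ENNReal.ofReal ((a - b * x) ^ 2) ∂gaussianReal m v
      = ∫⁻ y, ENNReal.ofReal (y ^ 2)
          ∂gaussianReal (a - b * m) (NNReal.mk (b ^ 2) (sq_nonneg b) * v) := by
        rw [← hmap, lintegral_map (by fun_prop) (by fun_prop)]
    _ = ENNReal.ofReal ((a - b * m) ^ 2 + b ^ 2 * v) := by
        have hsq : Integrable (fun y : ℝ => y ^ 2)
            (gaussianReal (a - b * m) (NNReal.mk (b ^ 2) (sq_nonneg b) * v)) :=
          (memLp_id_gaussianReal 2).integrable_sq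
        rw [← ofReal_integral_eq_lintegral_ofReal hsq (ae_of_all _ fun y => sq_nonneg y),
          integral_sq_gaussianReal, NNReal.coe_mul, NNReal.coe_mk]

/-- The variance of a normal state with prior variance `p`, given a normal signal of variance
`q`. -/
def posteriorVariance (p q : ℝ≥0) : ℝ≥0 := p * q / (p + q)

theorem posteriorVariance_pos {p q : ℝ≥0} (hp : 0 < p) (hq : 0 < q) :
    0 < posteriorVariance p q := by
  unfold posteriorVariance
  positivity

theorem posteriorVariance_lt {p : ℝ≥0} (hp : 0 < p) (q : ℝ≥0) : posteriorVariance p q < p := by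
  rw [posteriorVariance, div_lt_iff₀ (by positivity), mul_add]
  exact lt_add_of_pos_left _ (mul_pos hp hp)

theorem tendsto_posteriorVariance_atTop (p : ℝ≥0) :
    Tendsto (fun q => (posteriorVariance p q : ℝ)) atTop (𝓝 p) := by
  have hinv : Tendsto (fun q : ℝ≥0 => (q : ℝ)⁻¹) atTop (𝓝 0) :=
    (NNReal.tendsto_coe_atTop.2 tendsto_id).inv_tendsto_atTop
  have hlim : Tendsto (fun q : ℝ≥0 => (p : ℝ) / (p * (q : ℝ)⁻¹ + 1)) atTop
      (𝓝 (p / (p * 0 + 1))) :=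
    tendsto_const_nhds.div ((hinv.const_mul _).add_const 1) (by simp)
  rw [mul_zero, zero_add, div_one] at hlim
  refine hlim.congr' ?_
  filter_upwards [eventually_gt_atTop 0] with q hq
  have _ : (0 : ℝ) < q := hq
  rw [posteriorVariance]
  push_cast
  field_simp

/-- Bayes' rule for a normal prior and a normal signal. -/
theorem gaussianPDFReal_mul_gaussianPDFReal {p q : ℝ≥0} (hp : 0 < p) (hq : 0 < q) (m ω s : ℝ) :
    gaussianPDFReal ω q s * gaussianPDFReal m p ω =
      gaussianPDFReal m (p + q) s *
        gaussianPDFReal ((q * m + p * s) / (p + q)) (posteriorVariance p q) ω := by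
  have _ : (0 : ℝ) < p := hp
  have _ : (0 : ℝ) < q := hq
  simp only [gaussianPDFReal, posteriorVariance]
  rw [mul_mul_mul_comm, mul_mul_mul_comm (√(2 * Real.pi * ↑(p + q)))⁻¹, ← Real.exp_add,
    ← Real.exp_add, ← mul_inv, ← mul_inv, ← Real.sqrt_mul (by positivity),
    ← Real.sqrt_mul (by positivity)]
  push_cast
  congr 2
  · congr 1
    field_simp
  · field_simp
    ring

theorem integrable_gaussianPDFReal_mul_gaussianPDFReal {p q : ℝ≥0} (hp : 0 < p) (hq : 0 < q)
    (m s : ℝ) : Integrable fun ω => gaussianPDFReal ω q s * gaussianPDFReal m p ω := by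
  simp only [gaussianPDFReal_mul_gaussianPDFReal hp hq]
  exact (integrable_gaussianPDFReal _ _).const_mul _

theorem integral_gaussianPDFReal_mul_gaussianPDFReal {p q : ℝ≥0} (hp : 0 < p) (hq : 0 < q)
    (m s : ℝ) :
    ∫ ω, gaussianPDFReal ω q s * gaussianPDFReal m p ω = gaussianPDFReal m (p + q) s := by
  simp only [gaussianPDFReal_mul_gaussianPDFReal hp hq]
  rw [integral_const_mul, integral_gaussianPDFReal_eq_one _ (posteriorVariance_pos hp hq).ne',
    mul_one]

theorem integrable_sq_add_sq_mul_exp {b c : ℝ} (hb : 0 < b) (hc : 0 < c) :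
    Integrable fun z : ℝ × ℝ => (z.1 ^ 2 + z.2 ^ 2) *
      (Real.exp (-b * z.1 ^ 2) * Real.exp (-c * z.2 ^ 2)) := by
  have hsq : ∀ {d : ℝ}, 0 < d → Integrable fun t : ℝ => t ^ 2 * Real.exp (-d * t ^ 2) := by
    intro d hd
    simpa using integrable_rpow_mul_exp_neg_mul_sq hd (s := 2) (by norm_num)
  refine (((hsq hb).mul_prod (integrable_exp_neg_mul_sq hc)).add
    ((integrable_exp_neg_mul_sq hb).mul_prod (hsq hc))).congr (ae_of_all _ fun z => ?_)
  simp only [Pi.add_apply]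
  ring

end Gaussian

/-! ### Integrals -/

section Integrals

theorem lintegral_eq_mul_lintegral_comp_affine (u : ℝ → ℝ≥0∞) (b : ℝ) {c : ℝ} (hc : c ≠ 0) :
    ∫⁻ s, u s = ENNReal.ofReal |c| * ∫⁻ r, u (b + c * r) := by
  rw [← lintegral_add_left_eq_self u b]
  conv_lhs => rw [← Real.smul_map_volume_mul_left hc]
  rw [lintegral_smul_measure, (measurableEmbedding_mulLeft₀ hc).lintegral_map, smul_eq_mul]

theorem integral_eq_mul_integral_comp_affine (u : ℝ → ℝ) (b : ℝ) {c : ℝ} (hc : c ≠ 0) :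
    ∫ s, u s = |c| * ∫ r, u (b + c * r) := by
  rw [Measure.integral_comp_mul_left (fun y => u (b + y)) c, integral_add_left_eq_self u b,
    abs_inv, smul_eq_mul, mul_inv_cancel_left₀ (abs_ne_zero.2 hc)]

theorem lowerSemicontinuousOn_lintegral {X Y : Type*} [TopologicalSpace X]
    [FirstCountableTopology X] [MeasurableSpace Y] {μ : Measure Y} {S : Set X}
    {F : X → Y → ℝ≥0∞} (hF : ∀ x, Measurable (F x))
    (hS : ∀ y, LowerSemicontinuousOn (fun x => F x y) S) :
    LowerSemicontinuousOn (fun x => ∫⁻ y, F x y ∂μ) S := by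
  rw [lowerSemicontinuousOn_iff_le_liminf]
  intro x hx
  calc ∫⁻ y, F x y ∂μ ≤ ∫⁻ y, liminf (fun x' => F x' y) (𝓝[S] x) ∂μ :=
        lintegral_mono fun y => lowerSemicontinuousOn_iff_le_liminf.1 (hS y) x hx
    _ ≤ liminf (fun x' => ∫⁻ y, F x' y ∂μ) (𝓝[S] x) := lintegral_liminf_le hF

end Integrals

/-! ### Quadratic loss -/

section QuadraticLoss

/-- The expected quadratic loss of the decision rule `b` when the state and the signal, in this
order, have the joint density `k`. -/
def quadraticLoss (k : ℝ → ℝ → ℝ) (b : ℝ → ℝ) : ℝ≥0∞ :=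
  ∫⁻ z : ℝ × ℝ, ENNReal.ofReal ((z.1 - b z.2) ^ 2 * k z.1 z.2)

/-- The conditional expectation of the state given the signal `r` when they have the joint
density `k`, which need not be normalized. -/
def posteriorMean (k : ℝ → ℝ → ℝ) (r : ℝ) : ℝ := (∫ δ, δ * k δ r) / ∫ δ, k δ r

variable {k l : ℝ → ℝ → ℝ} {b : ℝ → ℝ}

theorem measurable_quadraticLoss_integrand (hk : Measurable k.uncurry) (hb : Measurable b) :
    Measurable fun z : ℝ × ℝ => ENNReal.ofReal ((z.1 - b z.2) ^ 2 * k z.1 z.2) :=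
  (((measurable_fst.sub (hb.comp measurable_snd)).pow_const 2).mul hk).ennreal_ofReal

theorem quadraticLoss_eq_lintegral_state (hk : Measurable k.uncurry) (hb : Measurable b) :
    quadraticLoss k b = ∫⁻ δ, ∫⁻ r, ENNReal.ofReal ((δ - b r) ^ 2 * k δ r) := by
  rw [quadraticLoss, Measure.volume_eq_prod,
    lintegral_prod _ (measurable_quadraticLoss_integrand hk hb).aemeasurable]

theorem quadraticLoss_eq_lintegral_signal (hk : Measurable k.uncurry) (hb : Measurable b) :
    quadraticLoss k b = ∫⁻ r, ∫⁻ δ, ENNReal.ofReal ((δ - b r) ^ 2 * k δ r) := by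
  rw [quadraticLoss, Measure.volume_eq_prod,
    lintegral_prod_symm' _ (measurable_quadraticLoss_integrand hk hb)]

theorem quadraticLoss_mul_add_mul (hk : Measurable k.uncurry) (hb : Measurable b)
    (hk0 : ∀ δ r, 0 ≤ k δ r) (hl0 : ∀ δ r, 0 ≤ l δ r) {c d : ℝ} (hc : 0 ≤ c) (hd : 0 ≤ d) :
    quadraticLoss (fun δ r => c * k δ r + d * l δ r) b =
      ENNReal.ofReal c * quadraticLoss k b + ENNReal.ofReal d * quadraticLoss l b := by
  have hsplit : ∀ z : ℝ × ℝ,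
      ENNReal.ofReal ((z.1 - b z.2) ^ 2 * (c * k z.1 z.2 + d * l z.1 z.2)) =
        ENNReal.ofReal c * ENNReal.ofReal ((z.1 - b z.2) ^ 2 * k z.1 z.2) +
          ENNReal.ofReal d * ENNReal.ofReal ((z.1 - b z.2) ^ 2 * l z.1 z.2) := by
    intro z
    have hkz := mul_nonneg (sq_nonneg (z.1 - b z.2)) (hk0 z.1 z.2)
    have hlz := mul_nonneg (sq_nonneg (z.1 - b z.2)) (hl0 z.1 z.2)
    rw [← ENNReal.ofReal_mul hc, ← ENNReal.ofReal_mul hd,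
      ← ENNReal.ofReal_add (mul_nonneg hc hkz) (mul_nonneg hd hlz)]
    congr 1
    ring
  simp only [quadraticLoss, hsplit]
  rw [lintegral_add_left ((measurable_quadraticLoss_integrand hk hb).const_mul _),
    lintegral_const_mul' _ _ ENNReal.ofReal_ne_top, lintegral_const_mul' _ _ ENNReal.ofReal_ne_top]

theorem lintegral_sub_mean_sq_mul_le {w : ℝ → ℝ} (hw0 : ∀ δ, 0 ≤ w δ) (hw : Integrable w)
    (hw1 : Integrable fun δ => δ * w δ) (hw2 : Integrable fun δ => δ ^ 2 * w δ)
    (hpos : 0 < ∫ δ, w δ) (c : ℝ) :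
    ∫⁻ δ, ENNReal.ofReal ((δ - (∫ δ, δ * w δ) / ∫ δ, w δ) ^ 2 * w δ) ≤
      ∫⁻ δ, ENNReal.ofReal ((δ - c) ^ 2 * w δ) := by
  set W := ∫ δ, w δ with hW
  set m := (∫ δ, δ * w δ) / W with hm
  have hmW : ∫ δ, δ * w δ = m * W := by rw [hm, div_mul_cancel₀ _ hpos.ne']
  have hint : ∀ d : ℝ, Integrable fun δ => (δ - d) ^ 2 * w δ := by
    intro d
    refine ((hw2.sub (hw1.const_mul (2 * d))).add (hw.const_mul (d ^ 2))).congr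
      (ae_of_all _ fun δ => ?_)
    simp only [Pi.add_apply, Pi.sub_apply]
    ring
  have hdev : ∫ δ, (δ - c) ^ 2 * w δ = (∫ δ, (δ - m) ^ 2 * w δ) + (m - c) ^ 2 * W := by
    have hpoint : ∀ δ, (δ - c) ^ 2 * w δ = (δ - m) ^ 2 * w δ +
        (2 * (m - c) * (δ * w δ) + ((m - c) ^ 2 - 2 * (m - c) * m) * w δ) := fun δ => by ring
    have hlin : Integrable fun δ =>
        2 * (m - c) * (δ * w δ) + ((m - c) ^ 2 - 2 * (m - c) * m) * w δ :=
      (hw1.const_mul _).add (hw.const_mul _)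
    rw [integral_congr_ae (ae_of_all _ hpoint), integral_add (hint m) hlin,
      integral_add (hw1.const_mul _) (hw.const_mul _), integral_const_mul, integral_const_mul,
      hmW, ← hW]
    ring
  have hnonneg : ∀ d : ℝ, ∀ᵐ δ, 0 ≤ (δ - d) ^ 2 * w δ := fun d =>
    ae_of_all _ fun δ => mul_nonneg (sq_nonneg _) (hw0 δ)
  rw [← ofReal_integral_eq_lintegral_ofReal (hint m) (hnonneg m),
    ← ofReal_integral_eq_lintegral_ofReal (hint c) (hnonneg c), hdev]
  exact ENNReal.ofReal_le_ofReal (le_add_of_nonneg_right (by positivity))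

theorem measurable_posteriorMean (hk : Measurable k.uncurry) : Measurable (posteriorMean k) :=
  (measurable_fst.mul hk).stronglyMeasurable.integral_prod_left'.measurable.div
    hk.stronglyMeasurable.integral_prod_left'.measurable

theorem quadraticLoss_posteriorMean_le (hk : Measurable k.uncurry) (hb : Measurable b)
    (hk0 : ∀ δ r, 0 ≤ k δ r) (hi0 : ∀ r, Integrable fun δ => k δ r)
    (hi1 : ∀ r, Integrable fun δ => δ * k δ r) (hi2 : ∀ r, Integrable fun δ => δ ^ 2 * k δ r)
    (hpos : ∀ r, 0 < ∫ δ, k δ r) :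
    quadraticLoss k (posteriorMean k) ≤ quadraticLoss k b := by
  rw [quadraticLoss_eq_lintegral_signal hk hb,
    quadraticLoss_eq_lintegral_signal hk (measurable_posteriorMean hk)]
  exact lintegral_mono fun r =>
    lintegral_sub_mean_sq_mul_le (hk0 · r) (hi0 r) (hi1 r) (hi2 r) (hpos r) (b r)

theorem mul_lintegral_le_quadraticLoss {A m : ℝ → ℝ} (hA : Measurable A) (hA0 : ∀ r, 0 ≤ A r)
    (hm : Measurable m) (hb : Measurable b) {τ : ℝ≥0} (hτ : τ ≠ 0) :
    τ * ∫⁻ r, ENNReal.ofReal (A r) ≤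
      quadraticLoss (fun δ r => A r * gaussianPDFReal (m r) τ δ) b := by
  have hk : Measurable (Function.uncurry fun δ r => A r * gaussianPDFReal (m r) τ δ) := by
    unfold gaussianPDFReal
    fun_prop
  rw [quadraticLoss_eq_lintegral_signal hk hb, ← lintegral_const_mul' _ _ ENNReal.coe_ne_top]
  refine lintegral_mono fun r => ?_
  calc (τ : ℝ≥0∞) * ENNReal.ofReal (A r)
      ≤ ENNReal.ofReal (A r) * ENNReal.ofReal ((b r - 1 * m r) ^ 2 + 1 ^ 2 * τ) := by
        rw [mul_comm, ← ENNReal.ofReal_coe_nnreal]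
        gcongr
        linarith [sq_nonneg (b r - 1 * m r)]
    _ = ∫⁻ δ, ENNReal.ofReal ((δ - b r) ^ 2 * (A r * gaussianPDFReal (m r) τ δ)) := by
        rw [← lintegral_sub_mul_sq_gaussianReal, ← lintegral_mul_gaussianPDFReal _ hτ,
          ← lintegral_const_mul' _ _ ENNReal.ofReal_ne_top]
        refine lintegral_congr fun δ => ?_
        rw [← ENNReal.ofReal_mul (hA0 r)]
        congr 1
        ring

theorem posteriorVariance_le_quadraticLoss {p q : ℝ≥0} (hp : 0 < p) (hq : 0 < q) (m : ℝ)
    (hb : Measurable b) : (posteriorVariance p q : ℝ≥0∞) ≤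
      quadraticLoss (fun δ r => gaussianPDFReal δ q r * gaussianPDFReal m p δ) b := by
  simp only [gaussianPDFReal_mul_gaussianPDFReal hp hq]
  refine le_trans ?_ (mul_lintegral_le_quadraticLoss (measurable_gaussianPDFReal m (p + q))
    (gaussianPDFReal_nonneg m (p + q)) (by fun_prop) hb (posteriorVariance_pos hp hq).ne')
  rw [lintegral_gaussianPDFReal_eq_one m (add_pos hp hq).ne', mul_one]

theorem quadraticLoss_const_mul_gaussian (β c m : ℝ) {p V : ℝ≥0} (hp : p ≠ 0) (hV : V ≠ 0) :
    quadraticLoss (fun δ r => gaussianPDFReal (c * δ) V r * gaussianPDFReal m p δ) (β * ·) =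
      ENNReal.ofReal ((1 - β * c) ^ 2 * (m ^ 2 + p) + β ^ 2 * V) := by
  have hk : Measurable (Function.uncurry fun δ r =>
      gaussianPDFReal (c * δ) V r * gaussianPDFReal m p δ) := by
    unfold gaussianPDFReal
    fun_prop
  have inner : ∀ δ : ℝ, ∫⁻ r, ENNReal.ofReal ((δ - β * r) ^ 2 *
      (gaussianPDFReal (c * δ) V r * gaussianPDFReal m p δ)) =
      ENNReal.ofReal (((0 - (1 - β * c) * δ) ^ 2 + β ^ 2 * V) * gaussianPDFReal m p δ) := by
    intro δ
    simp only [← mul_assoc, ENNReal.ofReal_mul' (gaussianPDFReal_nonneg m p δ)]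
    rw [lintegral_mul_const' _ _ ENNReal.ofReal_ne_top, lintegral_mul_gaussianPDFReal _ hV,
      lintegral_sub_mul_sq_gaussianReal]
    congr 2
    ring
  rw [quadraticLoss_eq_lintegral_state hk (by fun_prop)]
  simp only [inner]
  rw [lintegral_mul_gaussianPDFReal _ hp]
  simp only [ENNReal.ofReal_add (sq_nonneg _) (by positivity : 0 ≤ β ^ 2 * (V : ℝ))]
  rw [lintegral_add_right _ measurable_const, lintegral_sub_mul_sq_gaussianReal, lintegral_const,
    measure_univ, mul_one, ← ENNReal.ofReal_add (by positivity) (by positivity)]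
  congr 1
  ring

end QuadraticLoss

namespace NormalSampling

/-! ### A single source in compactified coordinates -/

section Source

/-- The factor `(1 - x) * q + x` by which rescaling and sampling divide the variance `q` of a
source, where `x = v / (1 + v)` encodes the sampling variance `v`. -/
def varRatio (q : ℝ≥0) (x : ℝ) : ℝ := (1 - x) * q + x

/-- The variance of the rescaled sampled signal of a source of variance `q`. -/
def scaledVar (q : ℝ≥0) (x : ℝ) : ℝ≥0 := (q / varRatio q x).toNNReal

/-- The density of the rescaled sampled signal `r` of a source of variance `q`, given the centred
state `δ` and up to a factor that depends only on `x`. The signal `s` is recovered from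
`s = ω₀ + √x * r`; the exponential is the sampling function `γ`. -/
def kern (q : ℝ≥0) (x δ r : ℝ) : ℝ :=
  Real.exp (-((1 - x) / 2) * r ^ 2) * gaussianPDFReal δ q (√x * r)

/-- The total mass of `kern q x δ`. -/
def mass (q : ℝ≥0) (x δ : ℝ) : ℝ :=
  (√(varRatio q x))⁻¹ * Real.exp (-((1 - x) / (2 * varRatio q x)) * δ ^ 2)

variable {q : ℝ≥0} {x : ℝ}

theorem varRatio_pos (hq : 0 < q) (hx : x ∈ Icc (0 : ℝ) 1) : 0 < varRatio q x := by
  have hq' : (0 : ℝ) < q := hq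
  rcases hx.1.eq_or_lt with rfl | hx0
  · simpa [varRatio] using hq
  · exact add_pos_of_nonneg_of_pos (mul_nonneg (sub_nonneg.2 hx.2) hq'.le) hx0

@[fun_prop]
theorem continuous_varRatio (q : ℝ≥0) : Continuous (varRatio q) := by
  unfold varRatio
  fun_prop

theorem coe_scaledVar (hq : 0 < q) (hx : x ∈ Icc (0 : ℝ) 1) :
    (scaledVar q x : ℝ) = q / varRatio q x :=
  Real.coe_toNNReal _ (div_nonneg q.coe_nonneg (varRatio_pos hq hx).le)

theorem scaledVar_pos (hq : 0 < q) (hx : x ∈ Icc (0 : ℝ) 1) : 0 < scaledVar q x :=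
  Real.toNNReal_pos.2 (div_pos (NNReal.coe_pos.2 hq) (varRatio_pos hq hx))

theorem kern_pos (hq : 0 < q) (x δ r : ℝ) : 0 < kern q x δ r :=
  mul_pos (Real.exp_pos _) (gaussianPDFReal_pos _ _ _ hq.ne')

theorem mass_pos (hq : 0 < q) (hx : x ∈ Icc (0 : ℝ) 1) (δ : ℝ) : 0 < mass q x δ :=
  mul_pos (inv_pos.2 (Real.sqrt_pos.2 (varRatio_pos hq hx))) (Real.exp_pos _)

theorem kern_eq_mass_mul (hq : 0 < q) (hx : x ∈ Icc (0 : ℝ) 1) (δ r : ℝ) :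
    kern q x δ r =
      mass q x δ * gaussianPDFReal (√x / varRatio q x * δ) (scaledVar q x) r := by
  have _ : (0 : ℝ) < q := hq
  have hD := varRatio_pos hq hx
  have hs : √x ^ 2 = x := Real.sq_sqrt hx.1
  simp only [kern, mass, gaussianPDFReal, coe_scaledVar hq hx]
  rw [mul_left_comm, mul_mul_mul_comm, ← Real.exp_add, ← Real.exp_add, ← mul_inv,
    ← Real.sqrt_mul hD.le]
  congr 2
  · congr 1
    field_simp
  · field_simp
    have hdef : varRatio q x = (1 - x) * q + x := rfl
    generalize varRatio q x = D at *
    generalize √x = t at *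
    subst hs hdef
    ring

theorem integrable_kern (hq : 0 < q) (hx : x ∈ Icc (0 : ℝ) 1) (δ : ℝ) :
    Integrable (kern q x δ) := by
  rw [funext (kern_eq_mass_mul hq hx δ)]
  exact (integrable_gaussianPDFReal _ _).const_mul _

theorem integral_kern (hq : 0 < q) (hx : x ∈ Icc (0 : ℝ) 1) (δ : ℝ) :
    ∫ r, kern q x δ r = mass q x δ := by
  simp only [kern_eq_mass_mul hq hx δ]
  rw [integral_const_mul, integral_gaussianPDFReal_eq_one _ (scaledVar_pos hq hx).ne', mul_one]

theorem continuous_kern (q : ℝ≥0) (δ r : ℝ) : Continuous fun x => kern q x δ r := by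
  unfold kern gaussianPDFReal
  fun_prop

theorem continuousOn_mass (hq : 0 < q) (δ : ℝ) :
    ContinuousOn (fun x => mass q x δ) (Icc 0 1) := by
  have hD : ∀ x ∈ Icc (0 : ℝ) 1, varRatio q x ≠ 0 := fun x hx => (varRatio_pos hq hx).ne'
  have hsqrt : ∀ x ∈ Icc (0 : ℝ) 1, √(varRatio q x) ≠ 0 := fun x hx =>
    (Real.sqrt_pos.2 (varRatio_pos hq hx)).ne'
  have h2D : ∀ x ∈ Icc (0 : ℝ) 1, 2 * varRatio q x ≠ 0 := fun x hx =>
    mul_ne_zero two_ne_zero (hD x hx)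
  unfold mass
  fun_prop (disch := assumption)

theorem measurable_kern (q : ℝ≥0) (x : ℝ) : Measurable (kern q x).uncurry := by
  unfold kern gaussianPDFReal
  fun_prop

theorem measurable_mass (q : ℝ≥0) (x : ℝ) : Measurable (mass q x) := by
  unfold mass
  fun_prop

theorem inv_one_add_inv_le_scaledVar (hq : 0 < q) (hx : x ∈ Icc (0 : ℝ) 1) :
    (1 + (q : ℝ)⁻¹)⁻¹ ≤ scaledVar q x := by
  have hq' : (0 : ℝ) < q := hq
  have hD : varRatio q x ≤ q + 1 :=
    add_le_add (mul_le_of_le_one_left hq'.le (sub_le_self 1 hx.1)) hx.2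
  calc (1 + (q : ℝ)⁻¹)⁻¹ = q / (q + 1) := by field_simp
    _ ≤ q / varRatio q x := div_le_div_of_nonneg_left hq'.le (varRatio_pos hq hx) hD
    _ = scaledVar q x := (coe_scaledVar hq hx).symm

theorem kern_le (hq : 0 < q) (hx : x ∈ Icc (0 : ℝ) 1) (δ r : ℝ) :
    kern q x δ r ≤ mass q x δ * √(1 + (q : ℝ)⁻¹) := by
  have hV := scaledVar_pos hq hx
  rw [kern_eq_mass_mul hq hx]
  refine mul_le_mul_of_nonneg_left ((gaussianPDFReal_le_inv_sqrt _ _ _).trans ?_)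
    (mass_pos hq hx δ).le
  rw [← Real.sqrt_inv]
  refine Real.sqrt_le_sqrt (inv_le_of_inv_le₀ (by positivity) ?_)
  refine (inv_one_add_inv_le_scaledVar hq hx).trans (le_mul_of_one_le_left hV.le ?_)
  linarith [Real.pi_gt_three]

end Source

/-! ### The model in compactified coordinates -/

variable {M : NormalSampling} {x : ℝ}

/-- The assumptions on the parameters of the model. -/
structure IsRegular (M : NormalSampling) : Prop where
  h_pos : 0 < M.h
  h_lt_one : M.h < 1
  v₀_pos : 0 < M.v₀
  vH_pos : 0 < M.vH
  vL_pos : 0 < M.vL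

/-- The average of `φ` over the variance of a random source. -/
def avg (M : NormalSampling) (φ : ℝ≥0 → ℝ) : ℝ := M.h * φ M.vH + (1 - M.h) * φ M.vL

/-- The density of the rescaled sampled signal `r` given the centred state `δ`. -/
def signalDensity (M : NormalSampling) (x δ r : ℝ) : ℝ := M.avg (kern · x δ r) / M.avg (mass · x δ)

/-- The joint density of the centred state `δ` and the rescaled sampled signal `r`. -/
def jointDensity (M : NormalSampling) (x δ r : ℝ) : ℝ :=
  M.signalDensity x δ r * gaussianPDFReal 0 M.v₀ δ

/-- The expected loss of the action rule `b` in the compactified coordinates. -/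
def loss (M : NormalSampling) (x : ℝ) (b : ℝ → ℝ) : ℝ≥0∞ := quadraticLoss (M.jointDensity x) b

section Average

variable {φ ψ : ℝ≥0 → ℝ}

theorem IsRegular.avg_pos (hM : M.IsRegular) (hH : 0 < φ M.vH) (hL : 0 < φ M.vL) : 0 < M.avg φ :=
  add_pos (mul_pos hM.h_pos hH) (mul_pos (sub_pos.2 hM.h_lt_one) hL)

theorem IsRegular.avg_le_avg (hM : M.IsRegular) (hH : φ M.vH ≤ ψ M.vH) (hL : φ M.vL ≤ ψ M.vL) :
    M.avg φ ≤ M.avg ψ :=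
  add_le_add (mul_le_mul_of_nonneg_left hH hM.h_pos.le)
    (mul_le_mul_of_nonneg_left hL (sub_nonneg.2 hM.h_lt_one.le))

theorem avg_const (M : NormalSampling) (c : ℝ) : M.avg (fun _ => c) = c := by
  rw [avg]
  ring

theorem avg_mul_const (M : NormalSampling) (φ : ℝ≥0 → ℝ) (c : ℝ) :
    M.avg (fun q => φ q * c) = M.avg φ * c := by
  simp only [avg]
  ring

theorem integral_avg {φ : ℝ≥0 → ℝ → ℝ} (hH : Integrable (φ M.vH)) (hL : Integrable (φ M.vL)) :
    ∫ y, M.avg (φ · y) = M.avg fun q => ∫ y, φ q y := by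
  simp only [avg]
  rw [integral_add (hH.const_mul _) (hL.const_mul _), integral_const_mul, integral_const_mul]

end Average

section JointDensity

theorem IsRegular.avg_mass_pos (hM : M.IsRegular) (hx : x ∈ Icc (0 : ℝ) 1) (δ : ℝ) :
    0 < M.avg (mass · x δ) :=
  hM.avg_pos (mass_pos hM.vH_pos hx δ) (mass_pos hM.vL_pos hx δ)

theorem IsRegular.signalDensity_pos (hM : M.IsRegular) (hx : x ∈ Icc (0 : ℝ) 1) (δ r : ℝ) :
    0 < M.signalDensity x δ r :=
  div_pos (hM.avg_pos (kern_pos hM.vH_pos _ _ _) (kern_pos hM.vL_pos _ _ _))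
    (hM.avg_mass_pos hx δ)

theorem IsRegular.exists_signalDensity_le (hM : M.IsRegular) :
    ∃ K : ℝ, ∀ x ∈ Icc (0 : ℝ) 1, ∀ δ r, M.signalDensity x δ r ≤ K := by
  set K : ℝ := max (√(1 + (M.vH : ℝ)⁻¹)) (√(1 + (M.vL : ℝ)⁻¹))
  refine ⟨K, fun x hx δ r => ?_⟩
  rw [signalDensity, div_le_iff₀ (hM.avg_mass_pos hx δ), mul_comm, ← avg_mul_const]
  exact hM.avg_le_avg
    ((kern_le hM.vH_pos hx δ r).trans
      (mul_le_mul_of_nonneg_left (le_max_left _ _) (mass_pos hM.vH_pos hx δ).le))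
    ((kern_le hM.vL_pos hx δ r).trans
      (mul_le_mul_of_nonneg_left (le_max_right _ _) (mass_pos hM.vL_pos hx δ).le))

theorem measurable_signalDensity (M : NormalSampling) (x : ℝ) :
    Measurable (M.signalDensity x).uncurry :=
  (((measurable_kern M.vH x).const_mul _).add ((measurable_kern M.vL x).const_mul _)).div
    ((((measurable_mass M.vH x).comp measurable_fst).const_mul _).add
      (((measurable_mass M.vL x).comp measurable_fst).const_mul _))

theorem measurable_jointDensity (M : NormalSampling) (x : ℝ) :
    Measurable (M.jointDensity x).uncurry :=
  (measurable_signalDensity M x).mul ((measurable_gaussianPDFReal 0 M.v₀).comp measurable_fst)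

theorem IsRegular.continuousOn_jointDensity (hM : M.IsRegular) (δ r : ℝ) :
    ContinuousOn (fun x => M.jointDensity x δ r) (Icc 0 1) :=
  (ContinuousOn.div
    (((continuous_kern M.vH δ r).const_mul _).add
      ((continuous_kern M.vL δ r).const_mul _)).continuousOn
    (((continuousOn_mass hM.vH_pos δ).const_mul _).add
      ((continuousOn_mass hM.vL_pos δ).const_mul _))
    fun _ hx => (hM.avg_mass_pos hx δ).ne').mul continuousOn_const

theorem IsRegular.jointDensity_pos (hM : M.IsRegular) (hx : x ∈ Icc (0 : ℝ) 1) (δ r : ℝ) :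
    0 < M.jointDensity x δ r :=
  mul_pos (hM.signalDensity_pos hx δ r) (gaussianPDFReal_pos _ _ _ hM.v₀_pos.ne')

theorem IsRegular.exists_norm_mul_jointDensity_le (hM : M.IsRegular) (u : ℝ → ℝ) :
    ∃ K : ℝ, ∀ x ∈ Icc (0 : ℝ) 1, ∀ δ r,
      ‖u δ * M.jointDensity x δ r‖ ≤ K * ‖u δ * gaussianPDFReal 0 M.v₀ δ‖ := by
  obtain ⟨K, hK⟩ := hM.exists_signalDensity_le
  refine ⟨K, fun x hx δ r => ?_⟩
  rw [jointDensity, mul_left_comm, norm_mul, Real.norm_of_nonneg (hM.signalDensity_pos hx δ r).le]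
  exact mul_le_mul_of_nonneg_right (hK x hx δ r) (norm_nonneg _)

variable {u : ℝ → ℝ}

theorem IsRegular.integrable_mul_jointDensity (hM : M.IsRegular) (hx : x ∈ Icc (0 : ℝ) 1) (r : ℝ)
    (hu : Measurable u) (hi : Integrable fun δ => u δ * gaussianPDFReal 0 M.v₀ δ) :
    Integrable fun δ => u δ * M.jointDensity x δ r := by
  obtain ⟨K, hK⟩ := hM.exists_norm_mul_jointDensity_le u
  exact (hi.norm.const_mul K).mono'
    (hu.mul (measurable_jointDensity M x).of_uncurry_right).aestronglyMeasurable
    (ae_of_all _ fun δ => hK x hx δ r)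

theorem IsRegular.continuousOn_integral_mul_jointDensity (hM : M.IsRegular) (r : ℝ)
    (hu : Measurable u) (hi : Integrable fun δ => u δ * gaussianPDFReal 0 M.v₀ δ) :
    ContinuousOn (fun x => ∫ δ, u δ * M.jointDensity x δ r) (Icc 0 1) := by
  obtain ⟨K, hK⟩ := hM.exists_norm_mul_jointDensity_le u
  exact continuousOn_of_dominated
    (fun x hx => (hM.integrable_mul_jointDensity hx r hu hi).aestronglyMeasurable)
    (fun x hx => ae_of_all _ fun δ => hK x hx δ r) (hi.norm.const_mul K)
    (ae_of_all _ fun δ => continuousOn_const.mul (hM.continuousOn_jointDensity δ r))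

theorem IsRegular.integrable_pow_mul_jointDensity (hM : M.IsRegular) (hx : x ∈ Icc (0 : ℝ) 1)
    (r : ℝ) (n : ℕ) : Integrable fun δ => δ ^ n * M.jointDensity x δ r :=
  hM.integrable_mul_jointDensity hx r (measurable_id.pow_const n)
    (integrable_pow_mul_gaussianPDFReal 0 hM.v₀_pos.ne' n)

theorem IsRegular.continuousOn_integral_pow_mul_jointDensity (hM : M.IsRegular) (r : ℝ) (n : ℕ) :
    ContinuousOn (fun x => ∫ δ, δ ^ n * M.jointDensity x δ r) (Icc 0 1) :=
  hM.continuousOn_integral_mul_jointDensity r (measurable_id.pow_const n)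
    (integrable_pow_mul_gaussianPDFReal 0 hM.v₀_pos.ne' n)

theorem IsRegular.integrable_jointDensity (hM : M.IsRegular) (hx : x ∈ Icc (0 : ℝ) 1) (r : ℝ) :
    Integrable fun δ => M.jointDensity x δ r := by
  simpa only [pow_zero, one_mul] using hM.integrable_pow_mul_jointDensity hx r 0

theorem IsRegular.integrable_id_mul_jointDensity (hM : M.IsRegular) (hx : x ∈ Icc (0 : ℝ) 1)
    (r : ℝ) : Integrable fun δ => δ * M.jointDensity x δ r := by
  simpa only [pow_one] using hM.integrable_pow_mul_jointDensity hx r 1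

theorem IsRegular.integral_jointDensity_pos (hM : M.IsRegular) (hx : x ∈ Icc (0 : ℝ) 1) (r : ℝ) :
    0 < ∫ δ, M.jointDensity x δ r := by
  have hpos := fun δ => hM.jointDensity_pos hx δ r
  have hsupport : (Function.support fun δ => M.jointDensity x δ r) = univ :=
    Set.eq_univ_of_forall fun δ => (hpos δ).ne'
  rw [integral_pos_iff_support_of_nonneg (fun δ => (hpos δ).le) (hM.integrable_jointDensity hx r),
    hsupport]
  simp

end JointDensity

/-! ### Action rules in compactified coordinates -/

/-- The weight on the prior mean, for a prior variance `p` and a source of variance `q`. -/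
def priorWeight (p q : ℝ≥0) (x : ℝ) : ℝ :=
  (p : ℝ)⁻¹ * x / ((p : ℝ)⁻¹ * x + (1 - x) + (q : ℝ)⁻¹ * x)

/-- The centred Bayes action. -/
def centredBayes (M : NormalSampling) (x : ℝ) : ℝ → ℝ := posteriorMean (M.jointDensity x)

/-- The probability that a centred signal `s` comes from a high-quality source. -/
def centredProbH (M : NormalSampling) (s : ℝ) : ℝ :=
  M.h * gaussianPDFReal 0 (M.v₀ + M.vH) s / M.avg fun q => gaussianPDFReal 0 (M.v₀ + q) s

/-- The weight that the weighted action puts on a centred signal `s`. -/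
def signalWeight (M : NormalSampling) (x s : ℝ) : ℝ :=
  1 - (M.centredProbH s * priorWeight M.v₀ M.vH x +
    (1 - M.centredProbH s) * priorWeight M.v₀ M.vL x)

/-- The centred weighted action. -/
def centredWeighted (M : NormalSampling) (x r : ℝ) : ℝ := M.signalWeight x (√x * r) * (√x * r)

theorem measurable_centredBayes (M : NormalSampling) (x : ℝ) : Measurable (M.centredBayes x) :=
  measurable_posteriorMean (measurable_jointDensity M x)

theorem IsRegular.continuousOn_centredBayes (hM : M.IsRegular) (r : ℝ) :
    ContinuousOn (fun x => M.centredBayes x r) (Icc 0 1) := by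
  have hmoment := hM.continuousOn_integral_pow_mul_jointDensity r
  have h0 := hmoment 0
  have h1 := hmoment 1
  simp only [pow_zero, one_mul] at h0
  simp only [pow_one] at h1
  exact h1.div h0 fun x hx => (hM.integral_jointDensity_pos hx r).ne'

theorem IsRegular.loss_centredBayes_le (hM : M.IsRegular) (hx : x ∈ Icc (0 : ℝ) 1) {b : ℝ → ℝ}
    (hb : Measurable b) : M.loss x (M.centredBayes x) ≤ M.loss x b :=
  quadraticLoss_posteriorMean_le (measurable_jointDensity M x) hb
    (fun δ r => (hM.jointDensity_pos hx δ r).le) (hM.integrable_jointDensity hx)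
    (hM.integrable_id_mul_jointDensity hx) (hM.integrable_pow_mul_jointDensity hx · 2)
    (hM.integral_jointDensity_pos hx)

section PriorWeight

variable {p : ℝ≥0}

theorem priorWeight_denom_pos (hp : 0 < p) (q : ℝ≥0) (hx : x ∈ Icc (0 : ℝ) 1) :
    0 < (p : ℝ)⁻¹ * x + (1 - x) + (q : ℝ)⁻¹ * x := by
  have hq : 0 ≤ (q : ℝ)⁻¹ * x := mul_nonneg (by positivity) hx.1
  rcases hx.1.eq_or_lt with rfl | hx0
  · simp
  · have hp' : 0 < (p : ℝ)⁻¹ * x := by positivity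
    linarith [hx.2]

theorem priorWeight_mem_Icc (hp : 0 < p) (q : ℝ≥0) (hx : x ∈ Icc (0 : ℝ) 1) :
    priorWeight p q x ∈ Icc (0 : ℝ) 1 := by
  have hdenom := priorWeight_denom_pos hp q hx
  have hp' : 0 ≤ (p : ℝ)⁻¹ * x := mul_nonneg (by positivity) hx.1
  have hq : 0 ≤ (q : ℝ)⁻¹ * x := mul_nonneg (by positivity) hx.1
  exact ⟨div_nonneg hp' hdenom.le, (div_le_one hdenom).2 (by linarith [hx.2])⟩

theorem continuousOn_priorWeight (hp : 0 < p) (q : ℝ≥0) :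
    ContinuousOn (priorWeight p q) (Icc 0 1) := by
  unfold priorWeight
  exact ContinuousOn.div (by fun_prop) (by fun_prop)
    fun x hx => (priorWeight_denom_pos hp q hx).ne'

end PriorWeight

theorem IsRegular.avg_gaussianPDFReal_pos (hM : M.IsRegular) (s : ℝ) :
    0 < M.avg fun q => gaussianPDFReal 0 (M.v₀ + q) s :=
  hM.avg_pos (gaussianPDFReal_pos _ _ _ (add_pos hM.v₀_pos hM.vH_pos).ne')
    (gaussianPDFReal_pos _ _ _ (add_pos hM.v₀_pos hM.vL_pos).ne')

theorem IsRegular.centredProbH_mem_Icc (hM : M.IsRegular) (s : ℝ) :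
    M.centredProbH s ∈ Icc (0 : ℝ) 1 :=
  ⟨div_nonneg (mul_nonneg hM.h_pos.le (gaussianPDFReal_nonneg _ _ _))
      (hM.avg_gaussianPDFReal_pos s).le,
    (div_le_one (hM.avg_gaussianPDFReal_pos s)).2 (le_add_of_nonneg_right
      (mul_nonneg (sub_pos.2 hM.h_lt_one).le (gaussianPDFReal_nonneg _ _ _)))⟩

theorem IsRegular.continuous_centredProbH (hM : M.IsRegular) : Continuous M.centredProbH :=
  ((continuous_gaussianPDFReal _ _).const_mul _).div
    (((continuous_gaussianPDFReal _ _).const_mul _).add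
      ((continuous_gaussianPDFReal _ _).const_mul _))
    fun s => (hM.avg_gaussianPDFReal_pos s).ne'

theorem IsRegular.signalWeight_mem_Icc (hM : M.IsRegular) (hx : x ∈ Icc (0 : ℝ) 1) (s : ℝ) :
    M.signalWeight x s ∈ Icc (0 : ℝ) 1 := by
  have hP := hM.centredProbH_mem_Icc s
  have havg := convex_Icc (0 : ℝ) 1 (priorWeight_mem_Icc hM.v₀_pos M.vH hx)
    (priorWeight_mem_Icc hM.v₀_pos M.vL hx) hP.1 (sub_nonneg.2 hP.2) (add_sub_cancel _ _)
  exact ⟨sub_nonneg.2 havg.2, sub_le_self 1 havg.1⟩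

theorem IsRegular.continuousOn_centredWeighted (hM : M.IsRegular) (r : ℝ) :
    ContinuousOn (fun x => M.centredWeighted x r) (Icc 0 1) := by
  have hP : ContinuousOn (fun x => M.centredProbH (√x * r)) (Icc 0 1) :=
    (hM.continuous_centredProbH.comp (by fun_prop)).continuousOn
  have hH := continuousOn_priorWeight hM.v₀_pos M.vH
  have hL := continuousOn_priorWeight hM.v₀_pos M.vL
  unfold centredWeighted signalWeight
  fun_prop

theorem measurable_centredWeighted (M : NormalSampling) (x : ℝ) :
    Measurable (M.centredWeighted x) := by
  have hP : Measurable M.centredProbH := by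
    unfold centredProbH avg gaussianPDFReal
    fun_prop
  unfold centredWeighted signalWeight
  fun_prop

theorem IsRegular.abs_centredWeighted_le (hM : M.IsRegular) (hx : x ∈ Icc (0 : ℝ) 1) (r : ℝ) :
    |M.centredWeighted x r| ≤ |r| := by
  have hw := hM.signalWeight_mem_Icc hx (√x * r)
  rw [centredWeighted, ← mul_assoc, abs_mul, abs_of_nonneg (mul_nonneg hw.1 (Real.sqrt_nonneg x))]
  exact mul_le_of_le_one_left (abs_nonneg r)
    (mul_le_one₀ hw.2 (Real.sqrt_nonneg x) (Real.sqrt_le_one.2 hx.2))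

/-! ### Lower bounds at the endpoints -/

/-- The expected loss of an agent who samples uniformly and is told the quality of the source. -/
def informedLoss (M : NormalSampling) : ℝ := M.avg fun q => posteriorVariance M.v₀ q

theorem IsRegular.informedLoss_le (hM : M.IsRegular) : M.informedLoss ≤ M.v₀ := by
  have hle := fun q => NNReal.coe_le_coe.2 (posteriorVariance_lt hM.v₀_pos q).le
  exact (hM.avg_le_avg (hle M.vH) (hle M.vL)).trans_eq (avg_const M _)

theorem IsRegular.jointDensity_zero (hM : M.IsRegular) (δ r : ℝ) :
    M.jointDensity 0 δ r = gaussianPDFReal 0 1 r * gaussianPDFReal 0 M.v₀ δ := by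
  have h0 : (0 : ℝ) ∈ Icc (0 : ℝ) 1 := left_mem_Icc.2 zero_le_one
  have hkern : ∀ {q : ℝ≥0}, 0 < q → kern q 0 δ r = mass q 0 δ * gaussianPDFReal 0 1 r := by
    intro q hq
    have hvar : scaledVar q 0 = 1 := by
      simp [scaledVar, varRatio, div_self (NNReal.coe_pos.2 hq).ne']
    rw [kern_eq_mass_mul hq h0, hvar, Real.sqrt_zero, zero_div, zero_mul]
  have havg : M.avg (kern · 0 δ r) = M.avg (mass · 0 δ) * gaussianPDFReal 0 1 r := by
    rw [← avg_mul_const, avg, hkern hM.vH_pos, hkern hM.vL_pos, avg]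
  rw [jointDensity, signalDensity, havg, mul_div_cancel_left₀ _ (hM.avg_mass_pos h0 δ).ne']

theorem IsRegular.informedLoss_le_loss_zero (hM : M.IsRegular) {b : ℝ → ℝ} (hb : Measurable b) :
    ENNReal.ofReal M.informedLoss ≤ M.loss 0 b := by
  calc ENNReal.ofReal M.informedLoss ≤ M.v₀ :=
        (ENNReal.ofReal_le_ofReal hM.informedLoss_le).trans_eq ENNReal.ofReal_coe_nnreal
    _ = M.v₀ * ∫⁻ r, ENNReal.ofReal (gaussianPDFReal 0 1 r) := by
        rw [lintegral_gaussianPDFReal_eq_one 0 one_ne_zero, mul_one]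
    _ ≤ quadraticLoss (fun δ r => gaussianPDFReal 0 1 r * gaussianPDFReal 0 M.v₀ δ) b :=
        mul_lintegral_le_quadraticLoss (measurable_gaussianPDFReal 0 1)
          (gaussianPDFReal_nonneg 0 1) measurable_const hb hM.v₀_pos.ne'
    _ = M.loss 0 b := by
        simp only [loss, quadraticLoss, hM.jointDensity_zero]

theorem jointDensity_one (M : NormalSampling) (δ r : ℝ) :
    M.jointDensity 1 δ r = M.h * (gaussianPDFReal δ M.vH r * gaussianPDFReal 0 M.v₀ δ) +
      (1 - M.h) * (gaussianPDFReal δ M.vL r * gaussianPDFReal 0 M.v₀ δ) := by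
  simp only [jointDensity, signalDensity, avg, mass, kern, varRatio, sub_self, zero_div, zero_mul,
    neg_zero, Real.exp_zero, Real.sqrt_one, inv_one, zero_add, one_mul, mul_one, add_sub_cancel,
    div_one]
  ring

theorem IsRegular.informedLoss_le_loss_one (hM : M.IsRegular) {b : ℝ → ℝ} (hb : Measurable b) :
    ENNReal.ofReal M.informedLoss ≤ M.loss 1 b := by
  have hh := hM.h_pos
  have hh' := sub_pos.2 hM.h_lt_one
  have hk : ∀ q : ℝ≥0, Measurable (Function.uncurry fun δ r =>
      gaussianPDFReal δ q r * gaussianPDFReal 0 M.v₀ δ) := by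
    intro q
    unfold gaussianPDFReal
    fun_prop
  have hk0 : ∀ (q : ℝ≥0) (δ r : ℝ), 0 ≤ gaussianPDFReal δ q r * gaussianPDFReal 0 M.v₀ δ :=
    fun q δ r => mul_nonneg (gaussianPDFReal_nonneg _ _ _) (gaussianPDFReal_nonneg _ _ _)
  have hloss : M.loss 1 b = quadraticLoss (fun δ r =>
      M.h * (gaussianPDFReal δ M.vH r * gaussianPDFReal 0 M.v₀ δ) +
        (1 - M.h) * (gaussianPDFReal δ M.vL r * gaussianPDFReal 0 M.v₀ δ)) b := by
    simp only [loss, quadraticLoss, jointDensity_one]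
  rw [hloss, quadraticLoss_mul_add_mul (hk _) hb (hk0 _) (hk0 _) hh.le hh'.le, informedLoss, avg,
    ENNReal.ofReal_add (by positivity) (by positivity), ENNReal.ofReal_mul hh.le,
    ENNReal.ofReal_mul hh'.le, ENNReal.ofReal_coe_nnreal, ENNReal.ofReal_coe_nnreal]
  gcongr
  · exact posteriorVariance_le_quadraticLoss hM.v₀_pos hM.vH_pos 0 hb
  · exact posteriorVariance_le_quadraticLoss hM.v₀_pos hM.vL_pos 0 hb

/-! ### Change of coordinates -/

section Coord

/-- The coordinate `v / (1 + v)` in `(0, 1]` of a sampling variance `v ∈ (0, ∞]`, written so that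
`v = ∞` has the coordinate `1`. -/
def coord (v : ℝ≥0∞) : ℝ := (1 + (v⁻¹).toReal)⁻¹

theorem coord_pos (v : ℝ≥0∞) : 0 < coord v := by
  unfold coord
  positivity

theorem coord_mem_Icc (v : ℝ≥0∞) : coord v ∈ Icc (0 : ℝ) 1 :=
  ⟨(coord_pos v).le, inv_le_one_of_one_le₀ (by simp)⟩

theorem coord_top : coord ∞ = 1 := by simp [coord]

theorem toReal_inv_mul_coord (v : ℝ≥0∞) : (v⁻¹).toReal * coord v = 1 - coord v := by
  have _ : 0 < 1 + (v⁻¹).toReal := by positivity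
  unfold coord
  field_simp
  ring

theorem exists_coord_eq (hx : x ∈ Ioc (0 : ℝ) 1) : ∃ v : ℝ≥0∞, 0 < v ∧ coord v = x := by
  have hinv : 0 ≤ x⁻¹ - 1 := sub_nonneg.2 ((one_le_inv₀ hx.1).2 hx.2)
  refine ⟨(ENNReal.ofReal (x⁻¹ - 1))⁻¹, by simp, ?_⟩
  rw [coord, inv_inv, ENNReal.toReal_ofReal hinv]
  simp

end Coord

variable {v : ℝ≥0∞}

theorem exists_γ_eq (M : NormalSampling) (hv : 0 < v) : ∃ C : ℝ, 0 < C ∧ ∀ r,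
    M.γ v (M.ω₀ + √(coord v) * r) = C * Real.exp (-((1 - coord v) / 2) * r ^ 2) := by
  by_cases htop : v = ∞
  · subst htop
    exact ⟨1, one_pos, fun r => by simp [γ, coord_top]⟩
  · lift v to ℝ≥0 using htop
    have hv' : 0 < v := by simpa using hv
    refine ⟨(√(2 * Real.pi * v))⁻¹, by positivity, fun r => ?_⟩
    rw [← toReal_inv_mul_coord]
    simp only [γ, ENNReal.coe_ne_top, if_false, ENNReal.toNNReal_coe, gaussianPDFReal,
      add_sub_cancel_left, mul_pow, Real.sq_sqrt (coord_pos v).le]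
    congr 2
    rw [← ENNReal.coe_inv hv'.ne', ENNReal.coe_toReal]
    push_cast
    field_simp

theorem prior_add (M : NormalSampling) (δ : ℝ) :
    M.prior (M.ω₀ + δ) = gaussianPDFReal 0 M.v₀ δ := by
  simp [prior, gaussianPDFReal]

theorem f_add_add (M : NormalSampling) (δ s : ℝ) :
    M.f (M.ω₀ + δ) (M.ω₀ + s) = M.avg fun q => gaussianPDFReal δ q s := by
  simp only [f, fH, fL, gaussianPDFReal_add_add, avg]

theorem IsRegular.sqrt_mul_g (hM : M.IsRegular) (hv : 0 < v) (δ r : ℝ) :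
    √(coord v) * M.g v (M.ω₀ + δ) (M.ω₀ + √(coord v) * r) = M.signalDensity (coord v) δ r := by
  obtain ⟨C, hC, hγ⟩ := M.exists_γ_eq hv
  have hs : 0 < √(coord v) := Real.sqrt_pos.2 (coord_pos v)
  have hx := coord_mem_Icc v
  have hnum : ∀ r, M.γ v (M.ω₀ + √(coord v) * r) * M.f (M.ω₀ + δ) (M.ω₀ + √(coord v) * r) =
      C * M.avg (kern · (coord v) δ r) := by
    intro r
    rw [hγ, f_add_add, avg, avg, kern, kern]
    ring
  have hdenom : ∫ s, M.γ v s * M.f (M.ω₀ + δ) s =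
      √(coord v) * (C * M.avg (mass · (coord v) δ)) := by
    rw [integral_eq_mul_integral_comp_affine _ M.ω₀ hs.ne', abs_of_pos hs]
    simp only [hnum]
    rw [integral_const_mul, integral_avg (integrable_kern hM.vH_pos hx δ)
      (integrable_kern hM.vL_pos hx δ), avg, integral_kern hM.vH_pos hx,
      integral_kern hM.vL_pos hx, avg]
  have hmass := hM.avg_mass_pos hx δ
  rw [g, hnum, hdenom, signalDensity]
  field_simp

theorem IsRegular.expectedLoss_eq (hM : M.IsRegular) (hv : 0 < v) {a b : ℝ → ℝ}
    (hb : Measurable b) (hab : ∀ r, a (M.ω₀ + √(coord v) * r) = M.ω₀ + b r) :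
    M.expectedLoss v a = M.loss (coord v) b := by
  have hs : 0 < √(coord v) := Real.sqrt_pos.2 (coord_pos v)
  rw [expectedLoss, ← lintegral_add_left_eq_self _ M.ω₀, loss,
    quadraticLoss_eq_lintegral_state (measurable_jointDensity M _) hb]
  refine lintegral_congr fun δ => ?_
  rw [lintegral_eq_mul_lintegral_comp_affine _ M.ω₀ hs.ne', abs_of_pos hs,
    ← lintegral_const_mul' _ _ ENNReal.ofReal_ne_top,
    ← lintegral_mul_const' _ _ ENNReal.ofReal_ne_top]
  refine lintegral_congr fun r => ?_
  rw [prior_add, ← ENNReal.ofReal_mul hs.le, ← ENNReal.ofReal_mul' (gaussianPDFReal_nonneg _ _ _),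
    mul_left_comm, hM.sqrt_mul_g hv, hab, add_sub_add_left_eq_sub, jointDensity, mul_assoc]

theorem IsRegular.bayesAction_eq (hM : M.IsRegular) (hv : 0 < v) (r : ℝ) :
    M.bayesAction v (M.ω₀ + √(coord v) * r) = M.ω₀ + M.centredBayes (coord v) r := by
  have hs : 0 < √(coord v) := Real.sqrt_pos.2 (coord_pos v)
  have hx := coord_mem_Icc v
  have hdensity : ∀ δ, M.g v (M.ω₀ + δ) (M.ω₀ + √(coord v) * r) * M.prior (M.ω₀ + δ) =
      (√(coord v))⁻¹ * M.jointDensity (coord v) δ r := by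
    intro δ
    rw [jointDensity, ← hM.sqrt_mul_g hv, prior_add]
    field_simp
  rw [bayesAction, ← integral_add_left_eq_self _ M.ω₀,
    ← integral_add_left_eq_self (fun ω => M.g v ω _ * M.prior ω) M.ω₀]
  simp only [hdensity, mul_left_comm _ (√(coord v))⁻¹]
  rw [integral_const_mul, integral_const_mul, mul_div_mul_left _ _ (inv_pos.2 hs).ne']
  simp only [add_mul]
  rw [integral_add ((hM.integrable_jointDensity hx r).const_mul _)
    (hM.integrable_id_mul_jointDensity hx r), integral_const_mul, add_div,
    mul_div_cancel_right₀ _ (hM.integral_jointDensity_pos hx r).ne', centredBayes, posteriorMean]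

theorem IsRegular.probH_add (hM : M.IsRegular) (s : ℝ) :
    M.probH (M.ω₀ + s) = M.centredProbH s := by
  have hH := integrable_gaussianPDFReal_mul_gaussianPDFReal hM.v₀_pos hM.vH_pos 0 s
  have hL := integrable_gaussianPDFReal_mul_gaussianPDFReal hM.v₀_pos hM.vL_pos 0 s
  rw [probH, ← integral_add_left_eq_self _ M.ω₀,
    ← integral_add_left_eq_self (fun ω => M.f ω _ * M.prior ω) M.ω₀]
  simp only [f_add_add, prior_add, fH, gaussianPDFReal_add_add, ← avg_mul_const, mul_assoc]
  rw [integral_avg hH hL, integral_const_mul, avg,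
    integral_gaussianPDFReal_mul_gaussianPDFReal hM.v₀_pos hM.vH_pos,
    integral_gaussianPDFReal_mul_gaussianPDFReal hM.v₀_pos hM.vL_pos, centredProbH, avg]

theorem α_eq_priorWeight (M : NormalSampling) (v : ℝ≥0∞) (q : ℝ≥0) :
    M.α v q = priorWeight M.v₀ q (coord v) := by
  rw [α, priorWeight, ← toReal_inv_mul_coord, ← add_mul, ← add_mul,
    mul_div_mul_right _ _ (coord_pos v).ne']

theorem IsRegular.weightedAction_eq (hM : M.IsRegular) (v : ℝ≥0∞) (r : ℝ) :
    M.weightedAction v (M.ω₀ + √(coord v) * r) = M.ω₀ + M.centredWeighted (coord v) r := by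
  rw [weightedAction, αbar, hM.probH_add, α_eq_priorWeight, α_eq_priorWeight, centredWeighted,
    signalWeight]
  ring

/-! ### Existence and finiteness of optimal sampling variances -/

/-- The action rules `b x` are those of the family `a` in compactified coordinates, and extend it
continuously to the coordinate `0`, where there is no sampling variance. -/
structure Compactifies (M : NormalSampling) (a : ℝ≥0∞ → ℝ → ℝ) (b : ℝ → ℝ → ℝ) : Prop where
  measurable : ∀ x, Measurable (b x)
  continuousOn : ∀ r, ContinuousOn (fun x => b x r) (Icc 0 1)
  action_eq : ∀ v, 0 < v → ∀ r, a v (M.ω₀ + √(coord v) * r) = M.ω₀ + b (coord v) r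

theorem IsRegular.compactifies_centredBayes (hM : M.IsRegular) :
    M.Compactifies M.bayesAction M.centredBayes :=
  ⟨M.measurable_centredBayes, hM.continuousOn_centredBayes, fun _ hv => hM.bayesAction_eq hv⟩

theorem IsRegular.compactifies_centredWeighted (hM : M.IsRegular) :
    M.Compactifies M.weightedAction M.centredWeighted :=
  ⟨M.measurable_centredWeighted, hM.continuousOn_centredWeighted,
    fun v _ => hM.weightedAction_eq v⟩

variable {a : ℝ≥0∞ → ℝ → ℝ} {b : ℝ → ℝ → ℝ}

theorem Compactifies.exists_isMinOn_loss (hab : M.Compactifies a b) (hM : M.IsRegular) :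
    ∃ x ∈ Icc (0 : ℝ) 1, IsMinOn (fun y => M.loss y (b y)) (Icc 0 1) x := by
  refine LowerSemicontinuousOn.exists_isMinOn (nonempty_Icc.2 zero_le_one) isCompact_Icc
    (lowerSemicontinuousOn_lintegral
      (fun x => measurable_quadraticLoss_integrand (measurable_jointDensity M x)
        (hab.measurable x))
      fun z => ContinuousOn.lowerSemicontinuousOn ?_)
  exact ENNReal.continuous_ofReal.comp_continuousOn
    (((continuousOn_const.sub (hab.continuousOn z.2)).pow 2).mul
      (hM.continuousOn_jointDensity z.1 z.2))

theorem Compactifies.expectedUtility_le_iff (hab : M.Compactifies a b) (hM : M.IsRegular)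
    {w : ℝ≥0∞} (hw : 0 < w) (hv : 0 < v) :
    M.expectedUtility w (a w) ≤ M.expectedUtility v (a v) ↔
      M.loss (coord v) (b (coord v)) ≤ M.loss (coord w) (b (coord w)) := by
  rw [expectedUtility, expectedUtility, EReal.neg_le_neg_iff,
    EReal.coe_ennreal_le_coe_ennreal_iff,
    hM.expectedLoss_eq hv (hab.measurable _) (hab.action_eq v hv),
    hM.expectedLoss_eq hw (hab.measurable _) (hab.action_eq w hw)]

theorem Compactifies.exists_isOptimalVariance (hab : M.Compactifies a b) (hM : M.IsRegular)
    (hx : x ∈ Icc (0 : ℝ) 1) (hlt : M.loss x (b x) < M.loss 0 (b 0)) :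
    ∃ v, M.IsOptimalVariance a v := by
  obtain ⟨y, hy, hmin⟩ := hab.exists_isMinOn_loss hM
  have hy0 : y ≠ 0 := by
    rintro rfl
    exact (hlt.trans_le (hmin hx)).false
  obtain ⟨v, hv, rfl⟩ := exists_coord_eq ⟨lt_of_le_of_ne hy.1 hy0.symm, hy.2⟩
  exact ⟨v, hv, fun w hw => (hab.expectedUtility_le_iff hM hw hv).2 (hmin (coord_mem_Icc w))⟩

theorem Compactifies.isOptimalVariance_lt_top (hab : M.Compactifies a b) (hM : M.IsRegular)
    (hx : x ∈ Ioc (0 : ℝ) 1) (hlt : M.loss x (b x) < M.loss 1 (b 1))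
    (hv : M.IsOptimalVariance a v) : v < ∞ := by
  obtain ⟨hv0, hopt⟩ := hv
  obtain ⟨w, hw, rfl⟩ := exists_coord_eq hx
  rw [lt_top_iff_ne_top]
  rintro rfl
  have hle := (hab.expectedUtility_le_iff hM hw hv0).1 (hopt w hw)
  rw [coord_top] at hle
  exact (hlt.trans_le hle).false

theorem Compactifies.exists_isOptimalVariance_and_forall_lt_top (hab : M.Compactifies a b)
    (hM : M.IsRegular) (hx : x ∈ Ioo (0 : ℝ) 1)
    (hlt : M.loss x (b x) < ENNReal.ofReal M.informedLoss) :
    (∃ v, M.IsOptimalVariance a v) ∧ ∀ v, M.IsOptimalVariance a v → v < ∞ :=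
  ⟨hab.exists_isOptimalVariance hM (Ioo_subset_Icc_self hx)
      (hlt.trans_le (hM.informedLoss_le_loss_zero (hab.measurable 0))),
    fun _ => hab.isOptimalVariance_lt_top hM (Ioo_subset_Ioc_self hx)
      (hlt.trans_le (hM.informedLoss_le_loss_one (hab.measurable 1)))⟩

/-! ### Low-quality sources of large variance -/

section Source

theorem tendsto_kern_atTop (x δ r : ℝ) : Tendsto (fun q => kern q x δ r) atTop (𝓝 0) := by
  have hpdf := tendsto_gaussianPDFReal_add_atTop δ (√x * r) 0
  simp only [zero_add] at hpdf
  unfold kern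
  simpa only [mul_zero] using hpdf.const_mul (Real.exp (-((1 - x) / 2) * r ^ 2))

theorem tendsto_mass_atTop (hx : x ∈ Ioo (0 : ℝ) 1) (δ : ℝ) :
    Tendsto (fun q => mass q x δ) atTop (𝓝 0) := by
  have hx' := Ioo_subset_Icc_self hx
  have h1x := sub_pos.2 hx.2
  have hvarRatio : Tendsto (fun q => varRatio q x) atTop atTop :=
    tendsto_atTop_add_const_right _ x
      ((NNReal.tendsto_coe_atTop.2 tendsto_id).const_mul_atTop h1x)
  refine squeeze_zero' ?_ ?_ (Real.tendsto_sqrt_atTop.comp hvarRatio).inv_tendsto_atTop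
  · filter_upwards [eventually_gt_atTop 0] with q hq
    exact (mass_pos hq hx' δ).le
  · filter_upwards [eventually_gt_atTop 0] with q hq
    have hD := varRatio_pos hq hx'
    refine mul_le_of_le_one_right (by positivity) (Real.exp_le_one_iff.2 ?_)
    rw [neg_mul, neg_nonpos]
    positivity

theorem tendsto_priorWeight_atTop {p : ℝ≥0} (hp : 0 < p) (hx : x ∈ Icc (0 : ℝ) 1) :
    Tendsto (fun q => priorWeight p q x) atTop
      (𝓝 ((p : ℝ)⁻¹ * x / ((p : ℝ)⁻¹ * x + (1 - x)))) := by
  have hinv : Tendsto (fun q : ℝ≥0 => (q : ℝ)⁻¹) atTop (𝓝 0) :=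
    (NNReal.tendsto_coe_atTop.2 tendsto_id).inv_tendsto_atTop
  have hdenom : (p : ℝ)⁻¹ * x + (1 - x) + 0 * x ≠ 0 := by
    simpa using (priorWeight_denom_pos hp 0 hx).ne'
  have hlim : Tendsto (fun q => priorWeight p q x) atTop
      (𝓝 ((p : ℝ)⁻¹ * x / ((p : ℝ)⁻¹ * x + (1 - x) + 0 * x))) :=
    tendsto_const_nhds.div ((hinv.mul_const x).const_add _) hdenom
  rwa [zero_mul, add_zero] at hlim

theorem kern_le_exp (q : ℝ≥0) (x δ r : ℝ) :
    kern q x δ r ≤ (√(2 * Real.pi * q))⁻¹ * Real.exp (-((1 - x) / 2) * r ^ 2) := by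
  rw [kern, mul_comm]
  exact mul_le_mul_of_nonneg_right (gaussianPDFReal_le_inv_sqrt _ _ _) (Real.exp_pos _).le

theorem gaussianPDFReal_div_mass (p q : ℝ≥0) (x δ : ℝ) :
    gaussianPDFReal 0 p δ / mass q x δ = (√(2 * Real.pi * p))⁻¹ * √(varRatio q x) *
      Real.exp (-((2 * p : ℝ)⁻¹ - (1 - x) / (2 * varRatio q x)) * δ ^ 2) := by
  rw [gaussianPDFReal, mass, div_eq_mul_inv, mul_inv, inv_inv, ← Real.exp_neg, mul_mul_mul_comm,
    ← Real.exp_add]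
  congr 2
  ring

theorem integrable_sq_add_sq_mul_gaussianPDFReal_div_mass {p q : ℝ≥0} (hx : x < 1)
    (hdecay : (1 - x) / (2 * varRatio q x) < (2 * p : ℝ)⁻¹) :
    Integrable fun z : ℝ × ℝ => (z.1 ^ 2 + z.2 ^ 2) *
      (gaussianPDFReal 0 p z.1 / mass q x z.1 * Real.exp (-((1 - x) / 2) * z.2 ^ 2)) := by
  simp only [gaussianPDFReal_div_mass]
  refine ((integrable_sq_add_sq_mul_exp (sub_pos.2 hdecay) (half_pos (sub_pos.2 hx))).const_mul
    ((√(2 * Real.pi * p))⁻¹ * √(varRatio q x))).congr (ae_of_all _ fun z => ?_)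
  ring

end Source

/-- The model in which the variance of the low-quality sources is replaced by `q`. -/
def withLow (M : NormalSampling) (q : ℝ≥0) : NormalSampling := { M with vL := q }

theorem IsRegular.withLow (hM : M.IsRegular) {q : ℝ≥0} (hq : 0 < q) : (M.withLow q).IsRegular :=
  ⟨hM.h_pos, hM.h_lt_one, hM.v₀_pos, hM.vH_pos, hq⟩

theorem tendsto_avg_withLow (M : NormalSampling) {φ : ℝ≥0 → ℝ} {l : ℝ}
    (hφ : Tendsto φ atTop (𝓝 l)) :
    Tendsto (fun q => (M.withLow q).avg φ) atTop (𝓝 (M.h * φ M.vH + (1 - M.h) * l)) :=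
  (hφ.const_mul _).const_add _

theorem tendsto_informedLoss_withLow (M : NormalSampling) :
    Tendsto (fun q => (M.withLow q).informedLoss) atTop
      (𝓝 (M.h * posteriorVariance M.v₀ M.vH + (1 - M.h) * M.v₀)) :=
  M.tendsto_avg_withLow (tendsto_posteriorVariance_atTop M.v₀)

theorem IsRegular.tendsto_jointDensity_withLow (hM : M.IsRegular) (hx : x ∈ Ioo (0 : ℝ) 1)
    (δ r : ℝ) :
    Tendsto (fun q => (M.withLow q).jointDensity x δ r) atTop
      (𝓝 (gaussianPDFReal (√x / varRatio M.vH x * δ) (scaledVar M.vH x) r *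
        gaussianPDFReal 0 M.v₀ δ)) := by
  have hx' := Ioo_subset_Icc_self hx
  have hmass : M.h * mass M.vH x δ + (1 - M.h) * 0 ≠ 0 := by
    rw [mul_zero, add_zero]
    exact (mul_pos hM.h_pos (mass_pos hM.vH_pos hx' δ)).ne'
  have hlim := (M.tendsto_avg_withLow (tendsto_kern_atTop x δ r)).div
    (M.tendsto_avg_withLow (tendsto_mass_atTop hx δ)) hmass
  rw [kern_eq_mass_mul hM.vH_pos hx', ← mul_assoc, mul_zero, add_zero, add_zero,
    mul_div_cancel_left₀ _ (by simpa using hmass)] at hlim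
  exact hlim.mul_const _

theorem IsRegular.tendsto_centredProbH_withLow (hM : M.IsRegular) (s : ℝ) :
    Tendsto (fun q => (M.withLow q).centredProbH s) atTop (𝓝 1) := by
  have hpos := mul_pos hM.h_pos
    (gaussianPDFReal_pos 0 (M.v₀ + M.vH) s (add_pos hM.v₀_pos hM.vH_pos).ne')
  have hlim := (tendsto_const_nhds (x := M.h * gaussianPDFReal 0 (M.v₀ + M.vH) s)).div
    (M.tendsto_avg_withLow (tendsto_gaussianPDFReal_add_atTop 0 s M.v₀))
    (by rw [mul_zero, add_zero]; exact hpos.ne')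
  rwa [mul_zero, add_zero, div_self hpos.ne'] at hlim

theorem IsRegular.tendsto_signalWeight_withLow (hM : M.IsRegular) (hx : x ∈ Icc (0 : ℝ) 1)
    (s : ℝ) :
    Tendsto (fun q => (M.withLow q).signalWeight x s) atTop
      (𝓝 (1 - priorWeight M.v₀ M.vH x)) := by
  have hP := hM.tendsto_centredProbH_withLow s
  have hlim := ((hP.mul_const (priorWeight M.v₀ M.vH x)).add
    ((hP.const_sub 1).mul (tendsto_priorWeight_atTop hM.v₀_pos hx))).const_sub 1
  rwa [sub_self, zero_mul, add_zero, one_mul] at hlim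

theorem IsRegular.tendsto_centredWeighted_withLow (hM : M.IsRegular) (hx : x ∈ Icc (0 : ℝ) 1)
    (r : ℝ) :
    Tendsto (fun q => (M.withLow q).centredWeighted x r) atTop
      (𝓝 ((1 - priorWeight M.v₀ M.vH x) * √x * r)) := by
  rw [mul_assoc]
  exact (hM.tendsto_signalWeight_withLow hx _).mul_const _

theorem IsRegular.jointDensity_withLow_le (hM : M.IsRegular) (hx : x ∈ Icc (0 : ℝ) 1) {q : ℝ≥0}
    (hq : 1 ≤ q) (δ r : ℝ) :
    (M.withLow q).jointDensity x δ r ≤ ((√(2 * Real.pi * M.vH))⁻¹ + 1) / M.h *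
      (gaussianPDFReal 0 M.v₀ δ / mass M.vH x δ * Real.exp (-((1 - x) / 2) * r ^ 2)) := by
  have hq0 : 0 < q := zero_lt_one.trans_le hq
  have hmass := mass_pos hM.vH_pos hx δ
  have hinv : (√(2 * Real.pi * q))⁻¹ ≤ 1 := by
    have _ : (1 : ℝ) ≤ q := by exact_mod_cast hq
    refine inv_le_one_of_one_le₀ (Real.one_le_sqrt.2 ?_)
    nlinarith [Real.pi_gt_three]
  have hnum : (M.withLow q).avg (kern · x δ r) ≤
      ((√(2 * Real.pi * M.vH))⁻¹ + 1) * Real.exp (-((1 - x) / 2) * r ^ 2) := by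
    have hN := hM.withLow hq0
    rw [← avg_const (M.withLow q) (_ * _)]
    exact hN.avg_le_avg
      ((kern_le_exp _ _ _ _).trans (mul_le_mul_of_nonneg_right
        (le_add_of_nonneg_right zero_le_one) (Real.exp_pos _).le))
      ((kern_le_exp _ _ _ _).trans (mul_le_mul_of_nonneg_right
        (hinv.trans (le_add_of_nonneg_left (by positivity))) (Real.exp_pos _).le))
  have hdenom : M.h * mass M.vH x δ ≤ (M.withLow q).avg (mass · x δ) :=
    le_add_of_nonneg_right
      (mul_pos (sub_pos.2 hM.h_lt_one) (mass_pos hq0 hx δ)).le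
  calc (M.withLow q).jointDensity x δ r
      ≤ ((√(2 * Real.pi * M.vH))⁻¹ + 1) * Real.exp (-((1 - x) / 2) * r ^ 2) /
          (M.h * mass M.vH x δ) * gaussianPDFReal 0 M.v₀ δ :=
        mul_le_mul_of_nonneg_right
          (div_le_div₀ (by positivity) hnum (mul_pos hM.h_pos hmass) hdenom)
          (gaussianPDFReal_nonneg _ _ _)
    _ = _ := by ring

/-- The limit of the loss of the weighted action as the variance of the low-quality sources tends
to infinity: the loss of a linear action rule for a single source of variance `vH`. -/
def limitLoss (M : NormalSampling) (x : ℝ) : ℝ :=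
  (1 - (1 - priorWeight M.v₀ M.vH x) * √x * (√x / varRatio M.vH x)) ^ 2 * M.v₀ +
    ((1 - priorWeight M.v₀ M.vH x) * √x) ^ 2 * (M.vH / varRatio M.vH x)

theorem IsRegular.ofReal_limitLoss (hM : M.IsRegular) (hx : x ∈ Icc (0 : ℝ) 1) :
    ENNReal.ofReal (M.limitLoss x) = quadraticLoss
      (fun δ r => gaussianPDFReal (√x / varRatio M.vH x * δ) (scaledVar M.vH x) r *
        gaussianPDFReal 0 M.v₀ δ) ((1 - priorWeight M.v₀ M.vH x) * √x * ·) := by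
  rw [quadraticLoss_const_mul_gaussian _ _ _ hM.v₀_pos.ne' (scaledVar_pos hM.vH_pos hx).ne',
    coe_scaledVar hM.vH_pos hx, zero_pow two_ne_zero, zero_add, limitLoss]

theorem IsRegular.tendsto_loss_centredWeighted_withLow (hM : M.IsRegular)
    (hx : x ∈ Ioo (0 : ℝ) 1) (hdecay : (1 - x) / (2 * varRatio M.vH x) < (2 * M.v₀ : ℝ)⁻¹) :
    Tendsto (fun q => (M.withLow q).loss x ((M.withLow q).centredWeighted x)) atTop
      (𝓝 (ENNReal.ofReal (M.limitLoss x))) := by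
  have hx' := Ioo_subset_Icc_self hx
  have henvelope := integrable_sq_add_sq_mul_gaussianPDFReal_div_mass hx.2 hdecay
  rw [hM.ofReal_limitLoss hx']
  refine tendsto_lintegral_filter_of_dominated_convergence _
    (Eventually.of_forall fun q => measurable_quadraticLoss_integrand
      (measurable_jointDensity _ x) (measurable_centredWeighted _ x)) ?_
    (henvelope.const_mul (2 * (((√(2 * Real.pi * M.vH))⁻¹ + 1) / M.h))).lintegral_lt_top.ne
    (ae_of_all _ fun z => (ENNReal.continuous_ofReal.tendsto _).comp
      ((((hM.tendsto_centredWeighted_withLow hx' z.2).const_sub z.1).pow 2).mul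
        (hM.tendsto_jointDensity_withLow hx z.1 z.2)))
  filter_upwards [eventually_ge_atTop 1] with q hq
  have hN := hM.withLow (zero_lt_one.trans_le hq)
  refine ae_of_all _ fun z => ENNReal.ofReal_le_ofReal ?_
  have hsq : (z.1 - (M.withLow q).centredWeighted x z.2) ^ 2 ≤ 2 * (z.1 ^ 2 + z.2 ^ 2) := by
    have hle := sq_le_sq.2 (hN.abs_centredWeighted_le hx' z.2)
    nlinarith [sq_nonneg (z.1 + (M.withLow q).centredWeighted x z.2)]
  calc (z.1 - (M.withLow q).centredWeighted x z.2) ^ 2 * (M.withLow q).jointDensity x z.1 z.2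
      ≤ 2 * (z.1 ^ 2 + z.2 ^ 2) * (((√(2 * Real.pi * M.vH))⁻¹ + 1) / M.h *
          (gaussianPDFReal 0 M.v₀ z.1 / mass M.vH x z.1 *
            Real.exp (-((1 - x) / 2) * z.2 ^ 2))) :=
        mul_le_mul hsq (hM.jointDensity_withLow_le hx' hq z.1 z.2)
          (hN.jointDensity_pos hx' _ _).le (by positivity)
    _ = _ := by ring

theorem IsRegular.limitLoss_one (hM : M.IsRegular) :
    M.limitLoss 1 = posteriorVariance M.v₀ M.vH := by
  have hv₀ : (0 : ℝ) < M.v₀ := hM.v₀_pos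
  have hvH : (0 : ℝ) < M.vH := hM.vH_pos
  simp only [limitLoss, priorWeight, varRatio, posteriorVariance, Real.sqrt_one, sub_self,
    zero_mul, zero_add, add_zero, mul_one, div_one, NNReal.coe_div, NNReal.coe_mul, NNReal.coe_add]
  field_simp
  ring

theorem IsRegular.continuousOn_limitLoss (hM : M.IsRegular) :
    ContinuousOn M.limitLoss (Icc 0 1) := by
  have hweight := continuousOn_priorWeight hM.v₀_pos M.vH
  have hD : ∀ x ∈ Icc (0 : ℝ) 1, varRatio M.vH x ≠ 0 := fun x hx => (varRatio_pos hM.vH_pos hx).ne'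
  unfold limitLoss
  fun_prop (disch := assumption)

theorem IsRegular.exists_limitLoss_lt (hM : M.IsRegular) : ∃ x ∈ Ioo (0 : ℝ) 1,
    (1 - x) / (2 * varRatio M.vH x) < (2 * M.v₀ : ℝ)⁻¹ ∧
      M.limitLoss x < M.h * posteriorVariance M.v₀ M.vH + (1 - M.h) * M.v₀ := by
  have h1 : (1 : ℝ) ∈ Icc (0 : ℝ) 1 := right_mem_Icc.2 zero_le_one
  have hD : ∀ x ∈ Icc (0 : ℝ) 1, 2 * varRatio M.vH x ≠ 0 := fun x hx =>
    mul_ne_zero two_ne_zero (varRatio_pos hM.vH_pos hx).ne'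
  have hdecay_cont : ContinuousOn (fun x => (1 - x) / (2 * varRatio M.vH x)) (Icc 0 1) := by
    fun_prop (disch := assumption)
  have hdecay_one : (1 - 1) / (2 * varRatio M.vH 1) < (2 * M.v₀ : ℝ)⁻¹ := by
    simpa using hM.v₀_pos
  have hloss_one : M.limitLoss 1 < M.h * posteriorVariance M.v₀ M.vH + (1 - M.h) * M.v₀ := by
    rw [hM.limitLoss_one]
    have hlt := mul_lt_mul_of_pos_left
      (NNReal.coe_lt_coe.2 (posteriorVariance_lt hM.v₀_pos M.vH)) (sub_pos.2 hM.h_lt_one)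
    linarith
  have hmono : 𝓝[Ioo 0 1] (1 : ℝ) ≤ 𝓝[Icc 0 1] 1 := nhdsWithin_mono _ Ioo_subset_Icc_self
  have hne : (𝓝[Ioo 0 1] (1 : ℝ)).NeBot :=
    mem_closure_iff_nhdsWithin_neBot.1 (by rwa [closure_Ioo zero_ne_one])
  obtain ⟨x, ⟨hdecay, hloss⟩, hx⟩ :=
    (((((hdecay_cont 1 h1).mono_left hmono).eventually_lt_const hdecay_one).and
      (((hM.continuousOn_limitLoss 1 h1).mono_left hmono).eventually_lt_const hloss_one)).and
      self_mem_nhdsWithin).exists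
  exact ⟨x, hx, hdecay, hloss⟩

theorem IsRegular.exists_eventually_loss_lt (hM : M.IsRegular) : ∃ x ∈ Ioo (0 : ℝ) 1,
    ∀ᶠ q in atTop, (M.withLow q).loss x ((M.withLow q).centredWeighted x) <
      ENNReal.ofReal (M.withLow q).informedLoss := by
  obtain ⟨x, hx, hdecay, hlt⟩ := hM.exists_limitLoss_lt
  have hpos : 0 < M.h * posteriorVariance M.v₀ M.vH + (1 - M.h) * M.v₀ :=
    add_pos_of_nonneg_of_pos (mul_nonneg hM.h_pos.le NNReal.zero_le_coe)
      (mul_pos (sub_pos.2 hM.h_lt_one) hM.v₀_pos)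
  exact ⟨x, hx, (hM.tendsto_loss_centredWeighted_withLow hx hdecay).eventually_lt
    (ENNReal.tendsto_ofReal M.tendsto_informedLoss_withLow)
    ((ENNReal.ofReal_lt_ofReal_iff hpos).2 hlt)⟩

end NormalSampling

end

theorem mainTheorem7 (h : ℝ) (h_pos : 0 < h) (h_lt_one : h < 1)
    (v₀ vH : ℝ≥0) (hv₀ : 0 < v₀) (hvH : 0 < vH) :
    ∃ κ : ℝ≥0, vH < κ ∧ ∀ (ω₀ : ℝ) (vL : ℝ≥0), κ < vL →
      let M : NormalSampling := { h := h, ω₀ := ω₀, v₀ := v₀, vH := vH, vL := vL }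
      ((∃ v, M.IsOptimalVariance M.bayesAction v) ∧
        ∀ v, M.IsOptimalVariance M.bayesAction v → v < ∞) ∧
      ((∃ v, M.IsOptimalVariance M.weightedAction v) ∧
        ∀ v, M.IsOptimalVariance M.weightedAction v → v < ∞) := by
  obtain ⟨x, hx, hlt⟩ := NormalSampling.IsRegular.exists_eventually_loss_lt
    (M := { h := h, ω₀ := 0, v₀ := v₀, vH := vH, vL := vH }) ⟨h_pos, h_lt_one, hv₀, hvH, hvH⟩
  obtain ⟨κ, hκ⟩ := Filter.eventually_atTop.1 (hlt.and (Filter.eventually_gt_atTop vH))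
  refine ⟨κ, (hκ κ le_rfl).2, fun ω₀ vL hL => ?_⟩
  intro M
  have hM : M.IsRegular := ⟨h_pos, h_lt_one, hv₀, hvH, hvH.trans (hκ vL hL.le).2⟩
  -- The compactified model does not involve the prior mean, so `κ` serves every `ω₀`.
  have hweighted : M.loss x (M.centredWeighted x) < ENNReal.ofReal M.informedLoss :=
    (hκ vL hL.le).1
  have hbayes : M.loss x (M.centredBayes x) < ENNReal.ofReal M.informedLoss :=
    (hM.loss_centredBayes_le (Set.Ioo_subset_Icc_self hx)
      (M.measurable_centredWeighted x)).trans_lt hweighted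
  exact ⟨hM.compactifies_centredBayes.exists_isOptimalVariance_and_forall_lt_top hM hx hbayes,
    hM.compactifies_centredWeighted.exists_isOptimalVariance_and_forall_lt_top hM hx hweighted⟩
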